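/- All sites $(\mathcal{C},J)$ are locally small and small generated: there is a small set of objects of $\mathcal{C}$ such that every object of $\mathcal{C}$ is $J$-covered by the arrows into it whose domains lie in that set. Write $\mathrm{Sh}(\mathcal{C},J)$ for the category of $J$-sheaves of (small) sets and $\mathfrak{a}_J$ for sheafification. A functor $f:\mathcal{C}\to\mathcal{D}$ is a *morphism of sites* $(\mathcal{C},J)\to(\mathcal{D},K)$ if it sends $J$-covering families to $K$-covering families and is covering-flat: for every finite diagram $(c_i)$ in $\mathcal{C}$ and every cone $(v_i:d\to f(c_i))$ over its image, the arrows $w:d'\to d$ for which there are a cone $(a_i:c\to c_i)$ in $\mathcal{C}$ and $u:d'\to f(c)$ with $f(a_i)u=v_iw$ for all $i$ form a $K$-covering sieve of $d$. It then induces a geometric morphism $\mathrm{Sh}(f):\mathrm{Sh}(\mathcal{D},K)\to\mathrm{Sh}(\mathcal{C},J)$, whose direct image $\mathrm{Sh}(f)_*$ is restriction along $f$. A functor $G:\mathcal{C}\to\mathcal{D}$ is a *comorphism of sites* $(\mathcal{C},J)\to(\mathcal{D},K)$ if for each object $c$ of $\mathcal{C}$ and each $K$-covering sieve $S$ on $G(c)$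 the sieve of arrows $v$ into $c$ with $G(v)\in S$ is $J$-covering. It then induces a geometric morphism $C_G:\mathrm{Sh}(\mathcal{C},J)\to\mathrm{Sh}(\mathcal{D},K)$ with $C_G^*(Y)=\mathfrak{a}_J(Y\circ G^{op})$. Given morphisms of sites $f:(\mathcal{A},M)\to(\mathcal{B},L)$, $h:(\mathcal{C},J)\to(\mathcal{D},K)$, comorphisms of sites $G:(\mathcal{A},M)\to(\mathcal{C},J)$, $k:(\mathcal{B},L)\to(\mathcal{D},K)$ and a natural transformation $\phi:kf\Rightarrow hG$, let $\beta: C_G^*\,\mathrm{Sh}(h)_*\Rightarrow \mathrm{Sh}(f)_*\,C_k^*$ be the transformation whose component at a sheaf $Y$ corresponds, under sheafification, to the composites $Y(hG(a))\xrightarrow{Y(\phi_a)}Y(kf(a))\to \mathfrak{a}_L(Y\circ k^{op})(f(a))$. The square is *locally exact* if the mate $\widetilde\phi:\mathrm{Sh}(f)^*C_G^*\Rightarrow C_k^*\,\mathrm{Sh}(h)^*$ of $\beta$ (formed with the unit of $\mathrm{Sh}(h)^*\dashv\mathrm{Sh}(h)_*$ and the counit of $\mathrm{Sh}(f)^*\dashv\mathrm{Sh}(f)_*$)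 is invertible. If $f:(\mathcal{C},J)\to(\mathcal{D},K)$ is both a morphism and a comorphism of sites, its *identity square* is the square with two sides $\mathrm{id}_{\mathcal{C}}$, the two other sides $f$ (once as a morphism, once as a comorphism of sites) and $\phi$ the identity; for it, $\widetilde\phi:\mathrm{Sh}(\mathrm{id})^*C_{\mathrm{id}}^*\Rightarrow C_f^*\,\mathrm{Sh}(f)^*$. A geometric morphism $p$ is *local* if $p_*$ has a fully faithful right adjoint. A geometric morphism $c$ is a *left-adjoint section* of $p$ if $c\dashv p$ in the 2-category of topoi (that is, $p^*\dashv c^*$) with invertible unit $\mathrm{id}\cong pc$. **Proposition.** Let $f:(\mathcal{C},J)\to(\mathcal{D},K)$ be both a morphism and a comorphism of sites. The following are equivalent: 1. $\mathrm{Sh}(f)$ is a local geometric morphism; 2. $\mathrm{Sh}(f)$ is a local geometric morphism and $C_f$ is a left-adjoint section of it; 3. the identity square of $f$ is ($J$-)locally exact; 4. $f$ is $J$-fully faithful: for all $u,v:c\to c'$ in $\mathcal{C}$ with $f(u)=f(v)$ there is a $J$-cover $(s_i:c_i\to c)$ with $us_i=vs_i$ for all $i$; and for every $u:f(c)\to f(c')$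 in $\mathcal{D}$ there are a $J$-cover $(s_i:c_i\to c)$ and arrows $v_i:c_i\to c'$ with $u\,f(s_i)=f(v_i)$ for all $i$. -/

import Mathlib

open CategoryTheory Limits Opposite

universe w u₁ u₂ u₃ u₄ v₁ v₂

namespace SiteSquares

/-- A site is small generated if it has a small dense subsite: a `w`-small family of objects
(equivalently, the full subcategory that they span) such that every object is covered by all the
arrows into it whose domain belongs to the family. Homs are `w`-small, as is implicit in
`Category.{w}`. -/
class IsSmallGenerated {C : Type u₁} [Category.{w} C] (J : GrothendieckTopology C) : Prop where
  exists_family : ∃ (I : Type w) (X : I → C), ∀ Y : C,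
    Sieve.ofArrows (fun p : Σ i, (X i ⟶ Y) => X p.1) (fun p => p.2) ∈ J Y

variable {C : Type u₁} [Category.{w} C] (J : GrothendieckTopology C)
  {D : Type u₂} [Category.{w} D] (K : GrothendieckTopology D)

section
variable [IsSmallGenerated.{w} J]
/-- The index set of a small generating family. -/
def GenIndex : Type w := (IsSmallGenerated.exists_family (J := J)).choose
/-- A small generating family of objects. -/
noncomputable def genObj : GenIndex J → C :=
  (IsSmallGenerated.exists_family (J := J)).choose_spec.choose
/-- The small dense full subcategory. -/
abbrev DenseCat : Type w := InducedCategory C (genObj J)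
/-- The inclusion of the small dense full subcategory. -/
noncomputable abbrev denseIncl : DenseCat J ⥤ C := inducedFunctor (genObj J)
/-- The topology induced on the small dense full subcategory. -/
noncomputable abbrev denseTop : GrothendieckTopology (DenseCat J) :=
  (denseIncl J).inducedTopology J

instance : (denseIncl J).IsCoverDense J where
  is_cover Y := by
    refine J.superset_covering ?_
      ((IsSmallGenerated.exists_family (J := J)).choose_spec.choose_spec Y)
    rintro Z _ ⟨_, a, _, ⟨⟨i, g⟩⟩, rfl⟩
    exact ⟨{ obj := (i : DenseCat J), lift := a, map := g, fac := rfl }⟩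

instance : (denseIncl J).IsOneHypercoverDense.{w} (denseTop J) J where
  nonempty_oneHypercoverDenseData Y := ⟨{
    I₀ := Σ X : DenseCat J, (denseIncl J).obj X ⟶ Y
    X := fun p => p.1
    f := fun p => p.2
    I₁ := fun p q => Σ W : DenseCat J, { h : (W ⟶ p.1) × (W ⟶ q.1) //
      (denseIncl J).map h.1 ≫ p.2 = (denseIncl J).map h.2 ≫ q.2 }
    Y := fun _ _ r => r.1
    p₁ := fun _ _ r => r.2.1.1
    p₂ := fun _ _ r => r.2.1.2
    w := fun _ _ r => r.2.2
    mem₀ := by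
      refine J.superset_covering ?_ ((denseIncl J).is_cover_of_isCoverDense J Y)
      rintro Z _ ⟨⟨X, a, g, rfl⟩⟩
      let k : Σ X : DenseCat J, (denseIncl J).obj X ⟶ Y := ⟨X, g⟩
      exact ⟨_, a, _, Presieve.ofArrows.mk k, rfl⟩
    mem₁₀ := fun p q W p₁ p₂ h => by
      refine GrothendieckTopology.superset_covering _ ?_ (GrothendieckTopology.top_mem _ W)
      intro Z g _
      let k : Σ W : DenseCat J, { h : (W ⟶ p.1) × (W ⟶ q.1) //
        (denseIncl J).map h.1 ≫ p.2 = (denseIncl J).map h.2 ≫ q.2 } := ⟨W, ⟨(p₁, p₂), h⟩⟩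
      exact ⟨k, g, rfl, rfl⟩ }⟩

instance isEquivalence_restrictDense :
    ((denseIncl J).sheafPushforwardContinuous (Type w) (denseTop J) J).IsEquivalence :=
  Functor.isEquivalence_of_isOneHypercoverDense.{w} _ _ _ _

instance hasSheafify : HasSheafify J (Type w) :=
  Functor.IsDenseSubsite.hasSheafify_of_isEquivalence (denseTop J) J (denseIncl J)
end


/-- For a cone `s` over the image under `f` of a diagram `F`, the sieve of all arrows `w` into the
apex of `s` such that `w ≫ s` factors, through some `u`, through the image of a cone over `F`. -/
def coneSieve (f : C ⥤ D) {I : Type} [SmallCategory I] {F : I ⥤ C} (s : Cone (F ⋙ f)) :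
    Sieve s.pt where
  arrows d w := ∃ (t : Cone F) (u : d ⟶ f.obj t.pt), ∀ i, u ≫ f.map (t.π.app i) = w ≫ s.π.app i
  downward_closed := by
    rintro d d' w ⟨t, u, h⟩ g
    exact ⟨t, g ≫ u, fun i => by rw [Category.assoc, h, Category.assoc]⟩

/-- A functor into a site is covering-flat if, for each finite diagram `F` and each cone over its
image, the sieve of arrows along which the cone factors through the image of a cone over `F` is
covering. -/
class IsCoveringFlat (f : C ⥤ D) : Prop where
  coneSieve_mem : ∀ {I : Type} [SmallCategory I] [FinCategory I] {F : I ⥤ C}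
    (s : Cone (F ⋙ f)), coneSieve f s ∈ K s.pt

/-- The property `P` of generalized elements holds locally over `d`. -/
def Loc (d : D) (P : ∀ ⦃d' : D⦄, (d' ⟶ d) → Prop) : Prop :=
  ∃ S ∈ K d, ∀ ⦃d' : D⦄ (w : d' ⟶ d), S w → P w

lemma Loc.bind {K : GrothendieckTopology D} {d : D} {P Q : ∀ ⦃d' : D⦄, (d' ⟶ d) → Prop}
    (h : Loc K d P) (h' : ∀ ⦃d' : D⦄ (w : d' ⟶ d), P w → Loc K d' (fun _ v => Q (v ≫ w))) :
    Loc K d Q := by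
  obtain ⟨S, hS, h⟩ := h
  choose T hT h' using h'
  refine ⟨Sieve.bind S.1 fun Y w hw => T w (h w hw), K.bind_covering hS fun Y w hw => hT _ _, ?_⟩
  rintro d' _ ⟨Y, g, w, hw, hg, rfl⟩
  exact h' w _ g hg

lemma Loc.mono {K : GrothendieckTopology D} {d : D} {P Q : ∀ ⦃d' : D⦄, (d' ⟶ d) → Prop}
    (h : Loc K d P) (h' : ∀ ⦃d' : D⦄ (w : d' ⟶ d), P w → Q w) : Loc K d Q := by
  obtain ⟨S, hS, h⟩ := h
  exact ⟨S, hS, fun _ w hw => h' w (h w hw)⟩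

lemma Loc.pullback {K : GrothendieckTopology D} {d : D} {P : ∀ ⦃d' : D⦄, (d' ⟶ d) → Prop}
    (h : Loc K d P) {d₁ : D} (w : d₁ ⟶ d) : Loc K d₁ (fun _ v => P (v ≫ w)) := by
  obtain ⟨S, hS, h⟩ := h
  exact ⟨S.pullback w, K.pullback_stable w hS, fun _ v hv => h _ hv⟩

lemma Loc.pure {K : GrothendieckTopology D} {d : D} {P : ∀ ⦃d' : D⦄, (d' ⟶ d) → Prop}
    (h : ∀ ⦃d' : D⦄ (w : d' ⟶ d), P w) : Loc K d P := ⟨⊤, K.top_mem d, fun _ w _ => h w⟩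

section
variable {B : Type u₃} [Category.{w} B] (f : B ⥤ D) [IsCoveringFlat K f]
lemma flat_nonempty (d : D) : Loc K d (fun d' _ => ∃ b, Nonempty (d' ⟶ f.obj b)) := by
  let s : Cone (Functor.empty.{0} B ⋙ f) :=
    { pt := d, π := { app := fun i => i.as.elim, naturality := fun i => i.as.elim } }
  exact ⟨_, IsCoveringFlat.coneSieve_mem (K := K) s, fun d' w ⟨t, u, _⟩ => ⟨t.pt, ⟨u⟩⟩⟩

lemma flat_pair {d : D} {b₁ b₂ : B} (v₁ : d ⟶ f.obj b₁) (v₂ : d ⟶ f.obj b₂) :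
    Loc K d (fun d' w => ∃ (b : B) (u : d' ⟶ f.obj b) (a₁ : b ⟶ b₁) (a₂ : b ⟶ b₂),
      u ≫ f.map a₁ = w ≫ v₁ ∧ u ≫ f.map a₂ = w ≫ v₂) := by
  let s : Cone (pair b₁ b₂ ⋙ f) :=
    { pt := d
      π := { app := by rintro ⟨⟨⟩⟩; exacts [v₁, v₂]
             naturality := by rintro ⟨⟨⟩⟩ ⟨⟨⟩⟩ ⟨⟨⟨⟩⟩⟩ <;> simp } }
  exact ⟨_, IsCoveringFlat.coneSieve_mem (K := K) s, fun d' w ⟨t, u, h⟩ =>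
    ⟨t.pt, u, t.π.app ⟨.left⟩, t.π.app ⟨.right⟩, h ⟨.left⟩, h ⟨.right⟩⟩⟩

lemma flat_eq {d : D} {b₁ b₂ : B} (v : d ⟶ f.obj b₁) (g₁ g₂ : b₁ ⟶ b₂)
    (h : v ≫ f.map g₁ = v ≫ f.map g₂) :
    Loc K d (fun d' w => ∃ (b : B) (u : d' ⟶ f.obj b) (a : b ⟶ b₁),
      u ≫ f.map a = w ≫ v ∧ a ≫ g₁ = a ≫ g₂) := by
  let s : Cone (parallelPair g₁ g₂ ⋙ f) :=
    { pt := d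
      π := { app := by rintro ⟨⟩; exacts [v, v ≫ f.map g₁]
             naturality := by rintro _ _ ⟨⟩ <;> simp [h] } }
  exact ⟨_, IsCoveringFlat.coneSieve_mem (K := K) s, fun d' w ⟨t, u, hu⟩ =>
    ⟨t.pt, u, t.π.app .zero, hu .zero, (t.w WalkingParallelPairHom.left).trans
      (t.w WalkingParallelPairHom.right).symm⟩⟩

instance (J : GrothendieckTopology C) : IsCoveringFlat J (𝟭 C) where
  coneSieve_mem {I} _ _ F s := by
    refine J.superset_covering ?_ (J.top_mem _)
    intro d w _
    exact ⟨⟨s.pt, s.π⟩, w, fun i => rfl⟩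

lemma compatiblePreserving : CompatiblePreserving.{u₄} K f where
  compatible P Z T x hx Y₁ Y₂ X f₁ f₂ g₁ g₂ hg₁ hg₂ e := by
    have key : Loc K X (fun d' w => P.obj.map w.op (P.obj.map f₁.op (x g₁ hg₁)) =
        P.obj.map w.op (P.obj.map f₂.op (x g₂ hg₂))) := by
      refine (flat_pair K f f₁ f₂).bind ?_
      rintro d w ⟨b, u, a₁, a₂, h₁, h₂⟩
      refine (flat_eq K f u (a₁ ≫ g₁) (a₂ ≫ g₂) ?_).mono ?_
      · simp only [Functor.map_comp, reassoc_of% h₁, reassoc_of% h₂, e]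
      · rintro d' w' ⟨b', u', a, h, h'⟩
        have := hx (a ≫ a₁) (a ≫ a₂) hg₁ hg₂ (by simpa using h')
        have e₁ : (w' ≫ w) ≫ f₁ = u' ≫ f.map (a ≫ a₁) := by
          rw [f.map_comp, reassoc_of% h, h₁, Category.assoc]
        have e₂ : (w' ≫ w) ≫ f₂ = u' ≫ f.map (a ≫ a₂) := by
          rw [f.map_comp, reassoc_of% h, h₂, Category.assoc]
        rw [← Functor.map_comp_apply, ← Functor.map_comp_apply, ← op_comp,
          ← op_comp, e₁, e₂, op_comp, op_comp, Functor.map_comp_apply,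
          Functor.map_comp_apply]
        exact congrArg (P.obj.map u'.op) this
    obtain ⟨S, hS, h⟩ := key
    exact (((isSheaf_iff_isSheaf_of_type _ _).1 P.property) S hS).isSeparatedFor.ext
      (fun _ w hw => h w hw)
end
section Lan
variable {B : Type w} [SmallCategory.{w} B] (G : B ⥤ D)

/-- The element of the left Kan extension of `X` along `G.op` represented by `v` and `x`. -/
noncomputable def el {X : Bᵒᵖ ⥤ Type w} {d : D} {b : B} (v : d ⟶ G.obj b) (x : X.obj (op b)) :
    (G.op.lan.obj X).obj (op d) :=
  (G.op.lan.obj X).map v.op ((G.op.lanUnit.app X).app (op b) x)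

lemma el_map {X : Bᵒᵖ ⥤ Type w} {d d' : D} {b : B} (v : d ⟶ G.obj b) (x : X.obj (op b))
    (w : d' ⟶ d) : (G.op.lan.obj X).map w.op (el G v x) = el G (w ≫ v) x := by
  simp [el]

lemma el_comp {X : Bᵒᵖ ⥤ Type w} {d : D} {b b' : B} (v : d ⟶ G.obj b) (a : b ⟶ b')
    (x : X.obj (op b')) : el G (v ≫ G.map a) x = el G v (X.map a.op x) := by
  simp [el]

lemma lan_map_el {X Y : Bᵒᵖ ⥤ Type w} (α : X ⟶ Y) {d : D} {b : B} (v : d ⟶ G.obj b)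
    (x : X.obj (op b)) :
    (G.op.lan.map α).app (op d) (el G v x) = el G v (α.app (op b) x) := by
  have h₁ := ConcreteCategory.congr_hom (congr_app (G.op.lanUnit.naturality α) (op b)) x
  have h₂ := ConcreteCategory.congr_hom ((G.op.lan.map α).naturality v.op)
    ((G.op.lanUnit.app X).app (op b) x)
  exact h₂.trans (congrArg ((G.op.lan.obj Y).map v.op) h₁.symm)

lemma el_surj {X : Bᵒᵖ ⥤ Type w} {d : D} (z : (G.op.lan.obj X).obj (op d)) :
    ∃ (b : B) (v : d ⟶ G.obj b) (x : X.obj (op b)), el G v x = z := by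
  obtain ⟨j, x, h⟩ := Types.jointly_surjective_of_isColimit
    (Functor.isPointwiseLeftKanExtensionOfIsLeftKanExtension _
      (G.op.lanUnit.app X) (op d)) z
  refine ⟨j.left.unop, j.hom.unop, x, ?_⟩
  exact h

lemma el_eq_of {X : Bᵒᵖ ⥤ Type w} {d : D} {b₁ b₂ b : B} {v₁ : d ⟶ G.obj b₁} {x₁ : X.obj (op b₁)}
    {v₂ : d ⟶ G.obj b₂} {x₂ : X.obj (op b₂)} (u : d ⟶ G.obj b) (a₁ : b ⟶ b₁) (a₂ : b ⟶ b₂)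
    (h₁ : u ≫ G.map a₁ = v₁) (h₂ : u ≫ G.map a₂ = v₂) (h₃ : X.map a₁.op x₁ = X.map a₂.op x₂) :
    el G v₁ x₁ = el G v₂ x₂ := by
  rw [← h₁, ← h₂, el_comp, el_comp, h₃]

variable [IsCoveringFlat K G]

/-- The two pairs represent locally the same element of the left Kan extension. -/
def Same (X : Bᵒᵖ ⥤ Type w) {d : D} {b₁ b₂ : B} (v₁ : d ⟶ G.obj b₁) (x₁ : X.obj (op b₁))
    (v₂ : d ⟶ G.obj b₂) (x₂ : X.obj (op b₂)) : Prop :=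
  Loc K d (fun d' w => ∃ (b : B) (u : d' ⟶ G.obj b) (a₁ : b ⟶ b₁) (a₂ : b ⟶ b₂),
    u ≫ G.map a₁ = w ≫ v₁ ∧ u ≫ G.map a₂ = w ≫ v₂ ∧ X.map a₁.op x₁ = X.map a₂.op x₂)

lemma flat_span {K : GrothendieckTopology D} {G : B ⥤ D} [IsCoveringFlat K G] {d : D} {b b₁ b₂ : B} {u₁ : d ⟶ G.obj b₁} {u₂ : d ⟶ G.obj b₂} (a₁ : b₁ ⟶ b)
    (a₂ : b₂ ⟶ b) (h : u₁ ≫ G.map a₁ = u₂ ≫ G.map a₂) :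
    Loc K d (fun d' w => ∃ (c : B) (u : d' ⟶ G.obj c) (e₁ : c ⟶ b₁) (e₂ : c ⟶ b₂),
      u ≫ G.map e₁ = w ≫ u₁ ∧ u ≫ G.map e₂ = w ≫ u₂ ∧ e₁ ≫ a₁ = e₂ ≫ a₂) := by
  refine (flat_pair K G u₁ u₂).bind ?_
  rintro d₁ w ⟨c, u, e₁, e₂, h₁, h₂⟩
  refine (flat_eq K G u (e₁ ≫ a₁) (e₂ ≫ a₂) ?_).mono ?_
  · simp only [Functor.map_comp, reassoc_of% h₁, reassoc_of% h₂, h]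
  · rintro d₂ w' ⟨c', u', e, h, h'⟩
    refine ⟨c', u', e ≫ e₁, e ≫ e₂, ?_, ?_, by simpa using h'⟩
    · rw [G.map_comp, reassoc_of% h, h₁, Category.assoc]
    · rw [G.map_comp, reassoc_of% h, h₂, Category.assoc]

lemma Same.trans {X : Bᵒᵖ ⥤ Type w} {d : D} {b₁ b₂ b₃ : B} {v₁ : d ⟶ G.obj b₁}
    {x₁ : X.obj (op b₁)} {v₂ : d ⟶ G.obj b₂} {x₂ : X.obj (op b₂)} {v₃ : d ⟶ G.obj b₃}
    {x₃ : X.obj (op b₃)} (h : Same K G X v₁ x₁ v₂ x₂) (h' : Same K G X v₂ x₂ v₃ x₃) :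
    Same K G X v₁ x₁ v₃ x₃ := by
  refine Loc.bind h ?_
  rintro d₁ w₁ ⟨b, u, a₁, a₂, h₁, h₂, h₃⟩
  refine Loc.bind (h'.pullback w₁) ?_
  rintro d₂ w₂ ⟨c, t, e₂, e₃, k₂, k₃, k⟩
  refine (flat_span (K := K) (u₁ := w₂ ≫ u) (u₂ := t) a₂ e₂ ?_).mono ?_
  · rw [k₂, Category.assoc, Category.assoc, h₂]
  · rintro d₃ w₃ ⟨z, q, y₁, y₂, l₁, l₂, l⟩
    refine ⟨z, q, y₁ ≫ a₁, y₂ ≫ e₃, ?_, ?_, ?_⟩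
    · simp [reassoc_of% l₁, h₁]
    · simp [reassoc_of% l₂, k₃]
    · have l' := congrArg (fun t => X.map t.op x₂) l
      simp only [op_comp, Functor.map_comp_apply] at l' ⊢
      rw [h₃, l', k]

lemma el_eq {X : Bᵒᵖ ⥤ Type w} {d : D} {b₁ b₂ : B} (v₁ : d ⟶ G.obj b₁) (x₁ : X.obj (op b₁))
    (v₂ : d ⟶ G.obj b₂) (x₂ : X.obj (op b₂)) (h : el G v₁ x₁ = el G v₂ x₂) :
    Same K G X v₁ x₁ v₂ x₂ := by
  have hc := Functor.isPointwiseLeftKanExtensionOfIsLeftKanExtension _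
      (G.op.lanUnit.app X) (op d)
  have hb := ((Types.isColimit_iff_coconeTypesIsColimit _).1 ⟨hc⟩).bijective.1
  let F := CostructuredArrow.proj G.op (op d) ⋙ X
  let p₁ : Σ j, F.obj j := ⟨(CostructuredArrow.mk (Y := op b₁) v₁.op : CostructuredArrow G.op (op d)), x₁⟩
  let p₂ : Σ j, F.obj j := ⟨(CostructuredArrow.mk (Y := op b₂) v₂.op : CostructuredArrow G.op (op d)), x₂⟩
  have hq : Quot.mk F.ColimitTypeRel p₁ = Quot.mk F.ColimitTypeRel p₂ := by
    apply hb
    simpa [el] using! h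
  have hE := Quot.eqvGen_exact hq
  let R (p q : Σ j, F.obj j) : Prop :=
    Same K G X p.1.hom.unop (p.2 : X.obj _) q.1.hom.unop (q.2 : X.obj _)
  suffices ∀ p q, Relation.EqvGen F.ColimitTypeRel p q → R p q from this _ _ hE
  intro p q hpq
  induction hpq with
  | rel p q hr =>
    obtain ⟨φ, hφ⟩ := hr
    apply Loc.pure
    intro d' w
    refine ⟨q.1.left.unop, w ≫ q.1.hom.unop, φ.left.unop, 𝟙 _, ?_, by simp, ?_⟩
    · have := congrArg Quiver.Hom.unop (CostructuredArrow.w φ)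
      simpa using congrArg (w ≫ ·) this
    · refine hφ.symm.trans ?_
      have := ConcreteCategory.congr_hom (X.map_id q.1.left) q.2
      exact this.symm
  | refl p => exact Loc.pure fun d' w => ⟨_, w ≫ p.1.hom.unop, 𝟙 _, 𝟙 _, by simp, by simp, rfl⟩
  | symm p q _ ih =>
    exact ih.mono fun d' w ⟨b, u, a₁, a₂, h₁, h₂, h₃⟩ => ⟨b, u, a₂, a₁, h₂, h₁, h₃.symm⟩
  | trans p q r _ _ ih₁ ih₂ => exact ih₁.trans K G ih₂

lemma isIso_sheafify_map [IsSmallGenerated.{w} K] {P Q : Dᵒᵖ ⥤ Type w} (φ : P ⟶ Q)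
    (hi : ∀ (d : D) (x y : P.obj (op d)), φ.app _ x = φ.app _ y →
      Loc K d (fun _ w => P.map w.op x = P.map w.op y))
    (hs : ∀ (d : D) (y : Q.obj (op d)),
      Loc K d (fun d' w => ∃ x : P.obj (op d'), φ.app _ x = Q.map w.op y)) :
    IsIso ((presheafToSheaf K (Type w)).map φ) := by
  let ι := denseIncl K
  have key : ∀ (X : DenseCat K) (S : Sieve (ι.obj X)), S ∈ K _ →
      S.functorPullback ι ∈ denseTop K X := fun X S hS => ι.cover_lift (denseTop K) K hS
  let φ₀ := ((Functor.whiskeringLeft _ _ (Type w)).obj ι.op).map φ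
  have h₁ : Presheaf.IsLocallyInjective (denseTop K) φ₀ := ⟨fun {X} x y h => by
    obtain ⟨S, hS, h'⟩ := hi _ x y h
    exact GrothendieckTopology.superset_covering _ (fun Z f hf => h' _ hf) (key _ S hS)⟩
  have h₂ : Presheaf.IsLocallySurjective (denseTop K) φ₀ := ⟨fun {X} y => by
    obtain ⟨S, hS, h'⟩ := hs _ y
    exact GrothendieckTopology.superset_covering _ (fun Z f hf => h' _ hf) (key _ S hS)⟩
  have h₃ : (denseTop K).W φ₀ := GrothendieckTopology.W_of_isLocallyBijective _ _
  rw [GrothendieckTopology.W_iff] at h₃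
  let e := Functor.IsDenseSubsite.sheafEquivSheafificationCompatibility (denseTop K) K ι (Type w)
  have h₄ : IsIso ((Functor.IsDenseSubsite.sheafEquiv (denseTop K) K ι (Type w)).inverse.map
      ((presheafToSheaf K (Type w)).map φ)) := by
    have := e.hom.naturality φ
    have h5 : IsIso (((Functor.whiskeringLeft _ _ (Type w)).obj ι.op ⋙ presheafToSheaf _ _).map φ) :=
      h₃
    exact ((NatIso.isIso_map_iff e φ).1 h5)
  exact isIso_of_reflects_iso _
    (Functor.IsDenseSubsite.sheafEquiv (denseTop K) K ι (Type w)).inverse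

lemma lan_sheafify_lex [IsSmallGenerated.{w} K] :
    PreservesFiniteLimits ((G.op.lan : (Bᵒᵖ ⥤ Type w) ⥤ _) ⋙ presheafToSheaf K (Type w)) := by
  have hT : PreservesLimit (Functor.empty.{0} (Bᵒᵖ ⥤ Type w))
      ((G.op.lan : (Bᵒᵖ ⥤ Type w) ⥤ _) ⋙ presheafToSheaf K (Type w)) := by
    let φ : G.op.lan.obj (⊤_ (Bᵒᵖ ⥤ Type w)) ⟶ ⊤_ (Dᵒᵖ ⥤ Type w) := terminal.from _
    have hφ : IsIso ((presheafToSheaf K (Type w)).map φ) := by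
      have e₁ (b : B) := PreservesTerminal.iso ((evaluation Bᵒᵖ (Type w)).obj (op b)) ≪≫
        Types.terminalIso
      have e₂ (d : D) := PreservesTerminal.iso ((evaluation Dᵒᵖ (Type w)).obj (op d)) ≪≫
        Types.terminalIso
      have sub₁ (b : B) (x y : (⊤_ (Bᵒᵖ ⥤ Type w)).obj (op b)) : x = y :=
        (e₁ b).toEquiv.injective (Subsingleton.elim (α := PUnit) _ _)
      have sub₂ (d : D) (x y : (⊤_ (Dᵒᵖ ⥤ Type w)).obj (op d)) : x = y :=
        (e₂ d).toEquiv.injective (Subsingleton.elim (α := PUnit) _ _)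
      have pt₁ (b : B) : Nonempty ((⊤_ (Bᵒᵖ ⥤ Type w)).obj (op b)) :=
        ⟨(e₁ b).toEquiv.symm PUnit.unit⟩
      apply isIso_sheafify_map
      · intro d x y _
        obtain ⟨b₁, v₁, x₁, rfl⟩ := el_surj G x
        obtain ⟨b₂, v₂, x₂, rfl⟩ := el_surj G y
        refine (flat_pair K G v₁ v₂).mono ?_
        rintro d' w ⟨b, u, a₁, a₂, h₁, h₂⟩
        rw [el_map, el_map]
        exact el_eq_of G u a₁ a₂ h₁ h₂ (sub₁ _ _ _)
      · intro d y
        refine (flat_nonempty K G d).mono ?_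
        rintro d' w ⟨b, ⟨u⟩⟩
        exact ⟨el G u (pt₁ b).some, sub₂ _ _ _⟩
    let ψ : (presheafToSheaf K (Type w)).obj (⊤_ (Dᵒᵖ ⥤ Type w)) ≅ ⊤_ _ :=
      PreservesTerminal.iso _
    exact preservesTerminal_of_isIso _ ((presheafToSheaf K (Type w)).map φ ≫ ψ.hom)
  have hP : PreservesLimitsOfShape WalkingCospan
      ((G.op.lan : (Bᵒᵖ ⥤ Type w) ⥤ _) ⋙ presheafToSheaf K (Type w)) := by
    suffices ∀ {X Y Z : Bᵒᵖ ⥤ Type w} (f : X ⟶ Z) (g : Y ⟶ Z), PreservesLimit (cospan f g)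
        ((G.op.lan : (Bᵒᵖ ⥤ Type w) ⥤ _) ⋙ presheafToSheaf K (Type w)) from
      ⟨fun {F} => preservesLimit_of_iso_diagram _ (diagramIsoCospan F).symm⟩
    intro X Y Z f g
    let φ := pullbackComparison (G.op.lan : (Bᵒᵖ ⥤ Type w) ⥤ (Dᵒᵖ ⥤ Type w)) f g
    have hφ : IsIso ((presheafToSheaf K (Type w)).map φ) := by
      have sq₁ (b : B) := (IsPullback.of_hasPullback f g).map ((evaluation _ _).obj (op b))
      have sq₂ (d : D) := (IsPullback.of_hasPullback (G.op.lan.map f) (G.op.lan.map g)).map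
        ((evaluation _ _).obj (op d))
      have fst_app (d : D) (z) : (pullback.fst (G.op.lan.map f) (G.op.lan.map g)).app (op d)
          (φ.app (op d) z) = (G.op.lan.map (pullback.fst f g)).app (op d) z :=
        ConcreteCategory.congr_hom (congr_app (pullbackComparison_comp_fst G.op.lan f g) (op d)) z
      have snd_app (d : D) (z) : (pullback.snd (G.op.lan.map f) (G.op.lan.map g)).app (op d)
          (φ.app (op d) z) = (G.op.lan.map (pullback.snd f g)).app (op d) z :=
        ConcreteCategory.congr_hom (congr_app (pullbackComparison_comp_snd G.op.lan f g) (op d)) z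
      apply isIso_sheafify_map
      · intro d x y hxy
        obtain ⟨b₁, v₁, x₁, rfl⟩ := el_surj G x
        obtain ⟨b₂, v₂, x₂, rfl⟩ := el_surj G y
        have e₁ := (fst_app d (el G v₁ x₁)).symm.trans ((congrArg _ hxy).trans (fst_app d _))
        have e₂ := (snd_app d (el G v₁ x₁)).symm.trans ((congrArg _ hxy).trans (snd_app d _))
        rw [lan_map_el, lan_map_el] at e₁ e₂
        refine Loc.bind (el_eq K G _ _ _ _ e₁) ?_
        rintro d₁ w₁ ⟨b, u, a₁, a₂, h₁, h₂, h⟩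
        refine Loc.bind ((el_eq K G _ _ _ _ e₂).pullback w₁) ?_
        rintro d₂ w₂ ⟨b', u', a₁', a₂', h₁', h₂', h'⟩
        refine Loc.bind (flat_span (K := K) (u₁ := w₂ ≫ u) (u₂ := u') a₁ a₁' ?_) ?_
        · rw [h₁', Category.assoc, Category.assoc, h₁]
        rintro d₃ w₃ ⟨c, t, p, p', k₁, k₂, k⟩
        refine (flat_eq K G t (p ≫ a₂) (p' ≫ a₂') ?_).mono ?_
        · rw [G.map_comp, G.map_comp, reassoc_of% k₁, reassoc_of% k₂, h₂', h₂]
          simp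
        rintro d₄ w₄ ⟨c', t', q, l₁, l₂⟩
        rw [el_map, el_map]
        refine el_eq_of G t' (q ≫ p ≫ a₁) (q ≫ p ≫ a₂) ?_ ?_ ?_
        · simp [reassoc_of% l₁, reassoc_of% k₁, h₁]
        · simp [reassoc_of% l₁, reassoc_of% k₁, h₂]
        · refine Types.ext_of_isPullback (sq₁ c') ?_ ?_
          · change (pullback.fst f g).app _ _ = (pullback.fst f g).app _ _
            rw [NatTrans.naturality_apply, NatTrans.naturality_apply]
            simp only [op_comp, Functor.map_comp_apply]
            rw [h]
          · change (pullback.snd f g).app _ _ = (pullback.snd f g).app _ _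
            rw [NatTrans.naturality_apply, NatTrans.naturality_apply, k, l₂]
            simp only [op_comp, Functor.map_comp_apply]
            rw [h']
      · intro d y
        obtain ⟨b₁, v₁, x₁, e₁⟩ := el_surj G ((pullback.fst _ _ : _ ⟶ G.op.lan.obj X).app (op d) y)
        obtain ⟨b₂, v₂, x₂, e₂⟩ := el_surj G ((pullback.snd _ _ : _ ⟶ G.op.lan.obj Y).app (op d) y)
        have e : (G.op.lan.map f).app (op d) (el G v₁ x₁) =
            (G.op.lan.map g).app (op d) (el G v₂ x₂) := by
          rw [e₁, e₂]
          exact ConcreteCategory.congr_hom (sq₂ d).w y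
        rw [lan_map_el, lan_map_el] at e
        refine Loc.mono (el_eq K G _ _ _ _ e) ?_
        rintro d₁ w₁ ⟨b, u, a₁, a₂, h₁, h₂, h⟩
        obtain ⟨z, hz₁, hz₂⟩ := Types.exists_of_isPullback (sq₁ b) (X.map a₁.op x₁) (Y.map a₂.op x₂) (by
          change f.app _ _ = g.app _ _
          rw [NatTrans.naturality_apply, NatTrans.naturality_apply, h])
        refine ⟨el G u z, Types.ext_of_isPullback (sq₂ d₁) ?_ ?_⟩
        · change (pullback.fst (G.op.lan.map f) (G.op.lan.map g)).app _ _ =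
            (pullback.fst (G.op.lan.map f) (G.op.lan.map g)).app _ _
          change (pullback.fst f g).app _ _ = _ at hz₁
          rw [fst_app, NatTrans.naturality_apply, ← e₁, lan_map_el, hz₁, el_map, ← h₁, el_comp]
        · change (pullback.snd (G.op.lan.map f) (G.op.lan.map g)).app _ _ =
            (pullback.snd (G.op.lan.map f) (G.op.lan.map g)).app _ _
          change (pullback.snd f g).app _ _ = _ at hz₂
          rw [snd_app, NatTrans.naturality_apply, ← e₂, lan_map_el, hz₂, el_map, ← h₂, el_comp]
    have : IsIso (pullbackComparison
        ((G.op.lan : (Bᵒᵖ ⥤ Type w) ⥤ _) ⋙ presheafToSheaf K (Type w)) f g) := by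
      rw [pullbackComparison_comp]
      exact IsIso.comp_isIso' hφ inferInstance
    exact PreservesPullback.of_iso_comparison _
  have hT' := preservesLimitsOfShape_pempty_of_preservesTerminal
    ((G.op.lan : (Bᵒᵖ ⥤ Type w) ⥤ _) ⋙ presheafToSheaf K (Type w))
  exact preservesFiniteLimits_of_preservesTerminal_and_pullbacks _
end Lan

/-- A morphism of sites is a covering-flat and cover-preserving functor. -/
class IsMorphismOfSites (f : C ⥤ D) : Prop where
  coveringFlat : IsCoveringFlat K f
  coverPreserving : CoverPreserving J K f

section
variable (f : C ⥤ D) [IsMorphismOfSites J K f]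

instance isContinuous_of_isMorphismOfSites : f.IsContinuous J K :=
  have := IsMorphismOfSites.coveringFlat (J := J) (K := K) (f := f)
  Functor.isContinuous_of_coverPreserving (compatiblePreserving K f)
    (IsMorphismOfSites.coverPreserving)

instance : IsMorphismOfSites J J (𝟭 C) where
  coveringFlat := inferInstance
  coverPreserving := idCoverPreserving J

lemma isCoveringFlat_denseIncl_comp [IsSmallGenerated.{w} J] :
    IsCoveringFlat K (denseIncl J ⋙ f) where
  coneSieve_mem {I} _ _ F s := by
    have := IsMorphismOfSites.coveringFlat (J := J) (K := K) (f := f)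
    let s' : Cone ((F ⋙ denseIncl J) ⋙ f) := { pt := s.pt, π := { app := fun i => s.π.app i, naturality := fun i j a => s.π.naturality a } }
    refine K.transitive (IsCoveringFlat.coneSieve_mem (K := K) s') _ ?_
    rintro d w ⟨t, u, h⟩
    have hc := (IsMorphismOfSites.coverPreserving (J := J) (K := K) (f := f)).cover_preserve
      ((denseIncl J).is_cover_of_isCoverDense J t.pt)
    refine K.superset_covering ?_ (K.pullback_stable u hc)
    rintro d' v ⟨Z, m, g, ⟨⟨X, l, p, rfl⟩⟩, hv⟩
    let t' : Cone F :=
      { pt := X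
        π :=
          { app := fun i => (denseIncl J).preimage (p ≫ t.π.app i)
            naturality := fun i j a => (denseIncl J).map_injective (by
              have := t.w a
              rw [Functor.comp_map] at this
              rw [Functor.map_comp, Functor.map_comp, Functor.map_preimage, Functor.map_preimage,
                Category.assoc, this]
              simp) } }
    refine ⟨t', g ≫ f.map l, fun i => ?_⟩
    have h' := v ≫= h i
    rw [reassoc_of% hv] at h'
    change (g ≫ f.map l) ≫ f.map ((denseIncl J).map ((denseIncl J).preimage (p ≫ t.π.app i))) =
      (v ≫ w) ≫ s.π.app i
    rw [Functor.map_preimage, Category.assoc, ← f.map_comp, Category.assoc, ← h']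
    simp
end

section
variable [IsSmallGenerated.{w} J] [IsSmallGenerated.{w} K] (f : C ⥤ D) [IsMorphismOfSites J K f]

lemma exists_shAdjunction : ∃ (L : Sheaf J (Type w) ⥤ Sheaf K (Type w)),
    Nonempty (L ⊣ f.sheafPushforwardContinuous (Type w) J K) ∧ PreservesFiniteLimits L := by
  let F := denseIncl J
  let R := F.sheafPushforwardContinuous (Type w) (denseTop J) J
  have hflat := isCoveringFlat_denseIncl_comp J K f
  have : (F ⋙ f).IsContinuous (denseTop J) K := Functor.isContinuous_comp F f (denseTop J) J K
  let L₀ := Functor.sheafPullbackConstruction.sheafPullback (F ⋙ f) (Type w) (denseTop J) K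
  let adj₀ : L₀ ⊣ (F ⋙ f).sheafPushforwardContinuous (Type w) (denseTop J) K :=
    Functor.sheafPullbackConstruction.sheafAdjunctionContinuous _ _ _ _
  have hL₀ : PreservesFiniteLimits L₀ := by
    have := lan_sheafify_lex K (F ⋙ f)
    exact comp_preservesFiniteLimits (sheafToPresheaf (denseTop J) (Type w)) _
  let e := R.asEquivalence
  let adj : R ⋙ L₀ ⊣ (F ⋙ f).sheafPushforwardContinuous (Type w) (denseTop J) K ⋙ e.inverse :=
    e.toAdjunction.comp adj₀
  refine ⟨R ⋙ L₀, ⟨adj.ofNatIsoRight ?_⟩, comp_preservesFiniteLimits _ _⟩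
  exact Functor.isoWhiskerLeft (f.sheafPushforwardContinuous (Type w) J K) e.unitIso.symm
end

/-- A geometric morphism from `E` to `F`: an adjunction whose left adjoint, the inverse image
`F ⥤ E`, preserves finite limits. -/
structure GeometricMorphism (E : Type u₃) [Category.{v₁} E] (F : Type u₄) [Category.{v₂} F] where
  inverseImage : F ⥤ E
  directImage : E ⥤ F
  adj : inverseImage ⊣ directImage
  lex : PreservesFiniteLimits inverseImage

namespace GeometricMorphism
variable {E : Type u₃} [Category.{v₁} E] {F : Type u₄} [Category.{v₂} F]

/-- A geometric morphism is local if its direct image has a fully faithful right adjoint. -/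
def IsLocal (p : GeometricMorphism E F) : Prop :=
  ∃ R : F ⥤ E, Nonempty (p.directImage ⊣ R) ∧ R.Full ∧ R.Faithful

/-- `c : F ⟶ E` is a section of `p : E ⟶ F` and is left adjoint to it. The 2-cells between
geometric morphisms are the natural transformations between inverse images, so an adjunction
`c ⊣ p` amounts to an adjunction `p^* ⊣ c^*` of functors, with the same unit `𝟭 ⟶ p^* ⋙ c^*`; the
composite of `c` and `p` is identified with the identity through this unit. -/
def IsLeftAdjointSection (c : GeometricMorphism F E) (p : GeometricMorphism E F) : Prop :=
  ∃ adj : p.inverseImage ⊣ c.inverseImage, IsIso adj.unit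
end GeometricMorphism

section
variable [IsSmallGenerated.{w} J] [IsSmallGenerated.{w} K] (f : C ⥤ D) [IsMorphismOfSites J K f]

instance : (f.sheafPushforwardContinuous (Type w) J K).IsRightAdjoint :=
  (exists_shAdjunction J K f).choose_spec.1.some.isRightAdjoint

/-- The geometric morphism `Sh(f) : Sh(D, K) ⟶ Sh(C, J)` of a morphism of sites `f`. Its direct
image is the restriction along `f`, and its inverse image is a left adjoint of the latter. -/
noncomputable def geomSh : GeometricMorphism (Sheaf K (Type w)) (Sheaf J (Type w)) where
  inverseImage := f.sheafPullback (Type w) J K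
  directImage := f.sheafPushforwardContinuous (Type w) J K
  adj := f.sheafAdjunctionContinuous (Type w) J K
  lex :=
    have := (exists_shAdjunction J K f).choose_spec.2
    preservesFiniteLimits_of_natIso
      ((exists_shAdjunction J K f).choose_spec.1.some.leftAdjointUniq
        (f.sheafAdjunctionContinuous (Type w) J K))
end

section
variable [IsSmallGenerated.{w} J] (G : C ⥤ D)

/-- The functor which restricts a sheaf along `G` and then sheafifies. -/
noncomputable def sheafRestrict : Sheaf K (Type w) ⥤ Sheaf J (Type w) :=
  sheafToPresheaf K (Type w) ⋙ (Functor.whiskeringLeft _ _ (Type w)).obj G.op ⋙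
    presheafToSheaf J (Type w)

lemma isLeftAdjoint_sheafRestrict [G.IsCocontinuous J K] :
    (sheafRestrict J K G).IsLeftAdjoint := by
  let F := denseIncl J
  let e := Functor.IsDenseSubsite.sheafEquiv (denseTop J) J F (Type w)
  have : F.IsCocontinuous (denseTop J) J := inferInstance
  have : (F ⋙ G).IsCocontinuous (denseTop J) K := isCocontinuous_comp F G (denseTop J) J
  let I₀ : Sheaf K (Type w) ⥤ Sheaf (denseTop J) (Type w) :=
    sheafToPresheaf K (Type w) ⋙ (Functor.whiskeringLeft _ _ (Type w)).obj (F ⋙ G).op ⋙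
      presheafToSheaf (denseTop J) (Type w)
  let adj' : (Functor.whiskeringLeft _ _ (Type w)).obj (F ⋙ G).op ⋙
      presheafToSheaf (denseTop J) (Type w) ⊣
      sheafToPresheaf (denseTop J) (Type w) ⋙ (F ⋙ G).op.ran :=
    ((F ⋙ G).op.ranAdjunction (Type w)).comp (sheafificationAdjunction (denseTop J) (Type w))
  let adj₀ : I₀ ⊣ (F ⋙ G).sheafPushforwardCocontinuous (Type w) (denseTop J) K :=
    adj'.restrictFullyFaithful (fullyFaithfulSheafToPresheaf K (Type w)) (.id _)
      (Iso.refl _) (Iso.refl _)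
  let i : I₀ ≅ sheafRestrict J K G ⋙ e.inverse :=
    Functor.isoWhiskerLeft (sheafToPresheaf K (Type w) ⋙
      (Functor.whiskeringLeft _ _ (Type w)).obj G.op)
      (Functor.IsDenseSubsite.sheafEquivSheafificationCompatibility (denseTop J) J F (Type w))
  let j : I₀ ⋙ e.functor ≅ sheafRestrict J K G :=
    Functor.isoWhiskerRight i e.functor ≪≫ Functor.associator _ _ _ ≪≫
      Functor.isoWhiskerLeft (sheafRestrict J K G) e.counitIso ≪≫ Functor.rightUnitor _
  exact ((adj₀.comp e.toAdjunction).ofNatIsoLeft j).isLeftAdjoint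

/-- The geometric morphism `C_G : Sh(C, J) ⟶ Sh(D, K)` of a comorphism of sites `G`, that is, of a
cover-lifting functor. Its inverse image restricts along `G` and sheafifies, and its direct image
is a right adjoint of the latter. -/
noncomputable def geomC [G.IsCocontinuous J K] :
    GeometricMorphism (Sheaf J (Type w)) (Sheaf K (Type w)) :=
  have := isLeftAdjoint_sheafRestrict J K G
  { inverseImage := sheafRestrict J K G
    directImage := (sheafRestrict J K G).rightAdjoint
    adj := Adjunction.ofIsLeftAdjoint _
    lex :=
      have : PreservesFiniteLimits ((Functor.whiskeringLeft _ _ (Type w)).obj G.op) :=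
        inferInstance
      have := comp_preservesFiniteLimits ((Functor.whiskeringLeft _ _ (Type w)).obj G.op)
        (presheafToSheaf J (Type w))
      comp_preservesFiniteLimits (sheafToPresheaf K (Type w)) _ }
end
section
variable {A : Type u₁} [Category.{w} A] {B : Type u₂} [Category.{w} B]
  {C : Type u₃} [Category.{w} C] {D : Type u₄} [Category.{w} D]
  (M : GrothendieckTopology A) (L : GrothendieckTopology B)
  (J : GrothendieckTopology C) (K : GrothendieckTopology D)
  [IsSmallGenerated.{w} M] [IsSmallGenerated.{w} L] [IsSmallGenerated.{w} J]
  [IsSmallGenerated.{w} K]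
  {f : A ⥤ B} {G : A ⥤ C} {k : B ⥤ D} {h : C ⥤ D}
  [IsMorphismOfSites M L f] [G.IsCocontinuous M J] [k.IsCocontinuous L K]
  [IsMorphismOfSites J K h]
  (φ : f ⋙ k ⟶ G ⋙ h)

/-- The transformation `C_G^* Sh(h)_* ⟶ Sh(f)_* C_k^*` of a lax square
`φ : f ⋙ k ⟶ G ⋙ h`. At a sheaf `Y` it corresponds, by the universal property of sheafification,
to `Y (h (G a)) ⟶ Y (k (f a))`, the restriction along `φ`, followed by the sheafification map of
`k.op ⋙ Y` at `f a`. -/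
noncomputable def restrictCell : (geomSh J K h).directImage ⋙ (geomC M J G).inverseImage ⟶
    (geomC L K k).inverseImage ⋙ (geomSh M L f).directImage where
  app Y := ((sheafificationAdjunction M (Type w)).homEquiv _ _).symm
    (Functor.whiskerRight (NatTrans.op φ) Y.obj ≫
      Functor.whiskerLeft f.op (toSheafify L (k.op ⋙ Y.obj)))
  naturality Y Y' a := by
    let adj := sheafificationAdjunction M (Type w)
    refine (adj.homEquiv_naturality_left_symm (((Functor.whiskeringLeft _ _ (Type w)).obj
      G.op).map (Functor.whiskerLeft h.op a.hom)) _).symm.trans (Eq.trans ?_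
      (adj.homEquiv_naturality_right_symm _ ((geomSh M L f).directImage.map
        ((geomC L K k).inverseImage.map a))))
    congr 1
    refine NatTrans.ext (funext fun b => ?_)
    have h₁ := congr_app (toSheafify_naturality L (Functor.whiskerLeft k.op a.hom))
      (op (f.obj b.unop))
    have h₂ := a.hom.naturality (φ.app b.unop).op
    change a.hom.app _ ≫ Y'.obj.map (φ.app b.unop).op ≫ (toSheafify L (k.op ⋙ Y'.obj)).app _ =
      (Y.obj.map (φ.app b.unop).op ≫ (toSheafify L (k.op ⋙ Y.obj)).app _) ≫
        (sheafifyMap L (Functor.whiskerLeft k.op a.hom)).app _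
    rw [Category.assoc]
    refine (Category.assoc _ _ _).symm.trans ((congrArg (· ≫ _) h₂.symm).trans ?_)
    exact (Category.assoc _ _ _).trans (congrArg (Y.obj.map (φ.app b.unop).op ≫ ·) h₁)

/-- The transformation `Sh(f)^* C_G^* ⟶ C_k^* Sh(h)^*` induced by a lax square `φ`: it is the mate
of `restrictCell`, that is, the composite of the unit of `Sh(h)^* ⊣ Sh(h)_*`, of `restrictCell`,
and of the counit of `Sh(f)^* ⊣ Sh(f)_*`. -/
noncomputable def sheafCell : (geomC M J G).inverseImage ⋙ (geomSh M L f).inverseImage ⟶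
    (geomSh J K h).inverseImage ⋙ (geomC L K k).inverseImage :=
  ((mateEquiv (geomSh J K h).adj (geomSh M L f).adj).symm
    (.mk _ _ _ _ (restrictCell M L J K φ))).natTrans

/-- A lax square from morphisms of sites `f`, `h` and comorphisms of sites `G`, `k` is locally exact
if the induced transformation `Sh(f)^* C_G^* ⟶ C_k^* Sh(h)^*` is invertible. -/
def IsLocallyExact : Prop := IsIso (sheafCell M L J K φ)
end

/-- The identity square of `f`, with two identity sides and with `f` as its two other sides: its
lower side is `f` seen as a morphism of sites, its right side is `f` seen as a comorphism. -/
def identitySquare (f : C ⥤ D) : 𝟭 C ⋙ f ⟶ 𝟭 C ⋙ f := 𝟙 _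

/-- `f` is `J`-fully faithful: arrows identified by `f` are locally equal, and any arrow
`f c ⟶ f c'` is, locally on `c`, in the image of `f`. -/
structure IsLocallyFullyFaithful (f : C ⥤ D) : Prop where
  faithful : ∀ ⦃c c' : C⦄ (u v : c ⟶ c'), f.map u = f.map v →
    ∃ S ∈ J c, ∀ ⦃b : C⦄ (s : b ⟶ c), S s → s ≫ u = s ≫ v
  full : ∀ ⦃c c' : C⦄ (u : f.obj c ⟶ f.obj c'),
    ∃ S ∈ J c, ∀ ⦃b : C⦄ (s : b ⟶ c), S s → ∃ v : b ⟶ c', f.map s ≫ u = f.map v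

end SiteSquares

open SiteSquares

/-!
Write `R = Sh(f)_*` for restriction of sheaves along `f` and `L = Sh(f)^*` for its left adjoint.
Since `f` is both a morphism and a comorphism of sites, restricting a sheaf along `f` already
yields a sheaf, so `C_f^*` is isomorphic to `R` (`sheafRestrictIso`). As `C_f^*` has a right
adjoint, so has `R`, and there is an adjoint triple `L ⊣ R ⊣ T` (`restrictTriple`). All the
conditions turn out to be equivalent to the invertibility of the unit of `L ⊣ R`:

* the right adjoint `T` is fully faithful if and only if the counit of `R ⊣ T` is invertible, which
  in an adjoint triple amounts to the invertibility of the unit of `L ⊣ R`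
  (`isLocal_geomSh_iff`); in that case `L ⊣ R ≅ C_f^*` makes `C_f` a left-adjoint section
  (`isLeftAdjointSection_geomC`);
* in the mate which defines the cell of the identity square, everything but the unit of `L ⊣ R` is
  invertible, and this unit is only transported along equivalences
  (`isLocallyExact_identitySquare_iff`);
* by the Yoneda lemma, the counit of `R ⊣ T` at a sheaf `Y` is, over an object `c`, given by
  precomposition with the canonical map `y c ⟶ R (a_K (y (f c)))`. Hence the counit is invertible
  if and only if each of these maps is inverted by sheafification
  (`isIso_counit_iff_W_yonedaToRestrict`), that is, if each is locally bijective. As `f` lifts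
  covers, this is local bijectivity of `y c ⟶ D(f -, f c)`, which says that `f` is locally fully
  faithful (`W_yonedaToRestrict_iff`).
-/

namespace SiteSquares

section
variable {C : Type u₁} [Category.{w} C] (J : GrothendieckTopology C)

/-- Sheafification inverts exactly the locally bijective maps, also over a large small generated
site: this transfers from the small dense subsite. -/
lemma wEqualsLocallyBijective_of_isSmallGenerated [IsSmallGenerated.{w} J] :
    J.WEqualsLocallyBijective (Type w) :=
  GrothendieckTopology.WEqualsLocallyBijective.transport J (denseTop J) (G := denseIncl J)
    (CoverPreserving.of_isContinuous (denseIncl J) (denseTop J) J)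

instance isEquivalence_sheafPushforwardContinuous_id :
    ((𝟭 C).sheafPushforwardContinuous (Type w) J J).IsEquivalence :=
  Functor.isEquivalence_of_iso (Functor.sheafPushforwardContinuousId (Type w) J).symm

variable {D : Type u₂} [Category.{w} D] (K : GrothendieckTopology D)
  [IsSmallGenerated.{w} K] (f : C ⥤ D)

/-- The canonical map from the presheaf represented by `c` to the restriction along `f` of the sheaf
associated with the presheaf represented by `f c`. -/
noncomputable def yonedaToRestrict (c : C) :
    yoneda.obj c ⟶ f.op ⋙ sheafify K (yoneda.obj (f.obj c)) :=
  yonedaMap f c ≫ Functor.whiskerLeft f.op (toSheafify K (yoneda.obj (f.obj c)))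

/-- The sheafification map of `y (f c)` is locally bijective, and remains so after restriction along
`f`, which lifts covers; so only the local bijectivity of `y c ⟶ D(f -, f c)` is at stake. -/
lemma W_yonedaToRestrict_iff [IsSmallGenerated.{w} J] [f.IsCocontinuous J K] :
    (∀ c, J.W (yonedaToRestrict K f c)) ↔ IsLocallyFullyFaithful J f := by
  have := wEqualsLocallyBijective_of_isSmallGenerated J
  have := wEqualsLocallyBijective_of_isSmallGenerated K
  have h (c : C) : J.W (yonedaToRestrict K f c) ↔
      Presheaf.IsLocallyInjective J (yonedaMap f c) ∧
        Presheaf.IsLocallySurjective J (yonedaMap f c) := by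
    have := Presheaf.isLocallyInjective_whisker J K f (toSheafify K (yoneda.obj (f.obj c)))
    have := Presheaf.isLocallySurjective_whisker J K f (toSheafify K (yoneda.obj (f.obj c)))
    rw [GrothendieckTopology.W_iff_isLocallyBijective, yonedaToRestrict,
      Presheaf.isLocallyInjective_comp_iff, Presheaf.isLocallySurjective_comp_iff]
  simp only [h]
  -- Local injectivity and surjectivity of `yonedaMap f c'` are, up to unfolding, the two clauses of
  -- local full faithfulness.
  constructor
  · refine fun H => ⟨fun c c' u v huv => ?_, fun c c' u => ?_⟩
    · have := (H c').1
      let u' : (yoneda.obj c').obj (op c) := u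
      let v' : (yoneda.obj c').obj (op c) := v
      exact ⟨Sieve.equalizer u v,
        Presheaf.equalizerSieve_mem J (yonedaMap f c') u' v' huv, fun _ _ hs => hs⟩
    · have := (H c').2
      let u' : (f.op ⋙ yoneda.obj (f.obj c')).obj (op c) := u
      exact ⟨_, Presheaf.imageSieve_mem J (yonedaMap f c') u', fun _ _ ⟨v, hv⟩ => ⟨v, hv.symm⟩⟩
  · refine fun H c' => ⟨⟨fun {X} u v huv => ?_⟩, ⟨fun {c} u => ?_⟩⟩
    · obtain ⟨S, hS, hS'⟩ := H.faithful (c := X.unop) (c' := c') u v huv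
      exact J.superset_covering (fun _ s hs => hS' s hs) hS
    · obtain ⟨S, hS, hS'⟩ := H.full (c := c) (c' := c') u
      exact J.superset_covering (fun _ s hs => (hS' s hs).imp fun _ hv => hv.symm) hS

variable [IsMorphismOfSites J K f]

section
variable {J K f}
variable {T : Sheaf J (Type w) ⥤ Sheaf K (Type w)}
  (adj : f.sheafPushforwardContinuous (Type w) J K ⊣ T)

/-- Sections over `f c` of the value of the right adjoint `T` of restriction at `Y`, as maps
from the restriction of the sheaf associated with `f c` to `Y`. -/
noncomputable def rightAdjointSectionsEquiv (Y : Sheaf J (Type w)) (c : C) :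
    (f.op ⋙ sheafify K (yoneda.obj (f.obj c)) ⟶ Y.obj) ≃ (T.obj Y).obj.obj (op (f.obj c)) :=
  ((fullyFaithfulSheafToPresheaf J (Type w)).homEquiv (X := (f.sheafPushforwardContinuous
      (Type w) J K).obj ((presheafToSheaf K (Type w)).obj (yoneda.obj (f.obj c))))).symm.trans
    ((adj.homEquiv _ Y).trans
      (((sheafificationAdjunction K (Type w)).homEquiv _ (T.obj Y)).trans yonedaEquiv))

/-- Through the Yoneda lemma, the counit of `R ⊣ T` over `c` is precomposition with
`yonedaToRestrict`. -/
lemma counit_rightAdjointSectionsEquiv (Y : Sheaf J (Type w)) (c : C)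
    (t : f.op ⋙ sheafify K (yoneda.obj (f.obj c)) ⟶ Y.obj) :
    (adj.counit.app Y).hom.app (op c) (rightAdjointSectionsEquiv adj Y c t) =
      yonedaEquiv (yonedaToRestrict K f c ≫ t) := by
  let A := (presheafToSheaf K (Type w)).obj (yoneda.obj (f.obj c))
  let s : (f.sheafPushforwardContinuous (Type w) J K).obj A ⟶ Y := ⟨t⟩
  let r : A ⟶ T.obj Y := adj.homEquiv _ _ s
  have hs : (f.sheafPushforwardContinuous (Type w) J K).map r ≫ adj.counit.app Y = s :=
    (adj.homEquiv_counit _ _ r).symm.trans ((adj.homEquiv _ _).symm_apply_apply s)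
  have hr : rightAdjointSectionsEquiv adj Y c t =
      r.hom.app (op (f.obj c)) ((toSheafify K (yoneda.obj (f.obj c))).app _ (𝟙 (f.obj c))) := by
    change yonedaEquiv ((sheafificationAdjunction K (Type w)).homEquiv _ (T.obj Y) r) = _
    rw [Adjunction.homEquiv_unit]
    rfl
  have ht := ConcreteCategory.congr_hom (congr_app (congrArg (·.hom) hs) (op c))
    ((toSheafify K (yoneda.obj (f.obj c))).app _ (𝟙 (f.obj c)))
  have hy : (yonedaMap f c).app (op c) (𝟙 c) = 𝟙 (f.obj c) := f.map_id c
  rw [hr]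
  refine ht.trans ?_
  change t.app (op c) _ = t.app (op c) ((toSheafify K (yoneda.obj (f.obj c))).app _
    ((yonedaMap f c).app (op c) (𝟙 c)))
  rw [hy]
  rfl

/-- The components of the counit at a sheaf `Y` are bijective exactly when every map out of `y c`
to `Y` extends uniquely along `yonedaToRestrict`; letting `Y` vary, this is the definition of
`J.W`. -/
lemma isIso_counit_iff_W_yonedaToRestrict :
    IsIso adj.counit ↔ ∀ c, J.W (yonedaToRestrict K f c) := by
  have key (Y : Sheaf J (Type w)) (c : C) :
      Function.Bijective ((adj.counit.app Y).hom.app (op c)) ↔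
        Function.Bijective
          (fun t : f.op ⋙ sheafify K (yoneda.obj (f.obj c)) ⟶ Y.obj =>
            yonedaToRestrict K f c ≫ t) := by
    refine (Function.Bijective.of_comp_iff _
      (rightAdjointSectionsEquiv adj Y c).bijective).symm.trans (Iff.trans ?_
      (Function.Bijective.of_comp_iff' yonedaEquiv.bijective _))
    exact iff_of_eq (congrArg _ (funext fun t => counit_rightAdjointSectionsEquiv adj Y c t))
  rw [NatTrans.isIso_iff_isIso_app]
  constructor
  · intro h c Y hY
    let Y' : Sheaf J (Type w) := ⟨Y, hY⟩
    have := h Y'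
    have : IsIso ((sheafToPresheaf J (Type w)).map (adj.counit.app Y')) := inferInstance
    have := (NatTrans.isIso_iff_isIso_app _).1 this (op c)
    exact (key Y' c).1 ((isIso_iff_bijective _).1 this)
  · intro h Y
    have : IsIso ((sheafToPresheaf J (Type w)).map (adj.counit.app Y)) := by
      rw [NatTrans.isIso_iff_isIso_app]
      exact fun c => (isIso_iff_bijective _).2 ((key Y c.unop).2 (h c.unop Y.obj Y.property))
    exact isIso_of_reflects_iso _ (sheafToPresheaf J (Type w))
end

variable [IsSmallGenerated.{w} J]

/-- If `f` is a morphism of sites, then restriction along `f` followed by sheafification agrees with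
restriction along `f`, which preserves sheaves. -/
noncomputable def sheafRestrictIso :
    sheafRestrict J K f ≅ (geomSh J K f).directImage :=
  Functor.isoWhiskerLeft (f.sheafPushforwardContinuous (Type w) J K)
    (asIso (sheafificationAdjunction J (Type w)).counit) ≪≫ Functor.rightUnitor _

section
variable [f.IsCocontinuous J K]

/-- The adjoint triple `Sh(f)^* ⊣ Sh(f)_* ≅ C_f^* ⊣ C_{f *}` of a functor which is both a morphism
and a comorphism of sites. -/
noncomputable def restrictTriple :
    Adjunction.Triple (geomSh J K f).inverseImage (geomSh J K f).directImage
      (geomC J K f).directImage where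
  adj₁ := (geomSh J K f).adj
  adj₂ := (geomC J K f).adj.ofNatIsoLeft (sheafRestrictIso J K f)

lemma isLocal_geomSh_iff :
    (geomSh J K f).IsLocal ↔ IsIso (geomSh J K f).adj.unit := by
  constructor
  · rintro ⟨T, ⟨adj⟩, _, _⟩
    let t : Adjunction.Triple (geomSh J K f).inverseImage (geomSh J K f).directImage T :=
      ⟨(geomSh J K f).adj, adj⟩
    exact t.isIso_unit_iff_isIso_counit.2 inferInstance
  · intro h
    let t := restrictTriple J K f
    have := t.isIso_unit_iff_isIso_counit.1 h
    let e := t.adj₂.fullyFaithfulROfIsIsoCounit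
    exact ⟨_, ⟨t.adj₂⟩, e.full, e.faithful⟩

lemma isLeftAdjointSection_geomC (h : IsIso (geomSh J K f).adj.unit) :
    (geomC J K f).IsLeftAdjointSection (geomSh J K f) := by
  let e := (geomSh J K f).adj.fullyFaithfulLOfIsIsoUnit
  have := e.full
  have := e.faithful
  exact ⟨(geomSh J K f).adj.ofNatIsoRight (sheafRestrictIso J K f).symm, inferInstance⟩

/-- The square has an identity 2-cell and compares two ways of restricting a sheaf along `f`, which
agree because the restriction is already a sheaf. -/
lemma isIso_restrictCell_identitySquare_app (Y : Sheaf K (Type w)) :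
    IsIso ((restrictCell J J J K (identitySquare f)).app Y) := by
  let adj := sheafificationAdjunction J (Type w)
  have hsheaf : Presheaf.IsSheaf J (f.op ⋙ Y.obj) := f.op_comp_isSheaf J K Y
  have : IsIso (toSheafify J (f.op ⋙ Y.obj)) := isIso_toSheafify J hsheaf
  have h₁ : IsIso (Functor.whiskerRight (NatTrans.op (identitySquare f)) Y.obj) := by
    have : IsIso (NatTrans.op (identitySquare f)) := by
      unfold identitySquare
      infer_instance
    infer_instance
  have h₂ : IsIso (Functor.whiskerLeft (𝟭 C).op (toSheafify J (f.op ⋙ Y.obj))) := inferInstance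
  have h₃ := IsIso.comp_isIso' h₁ h₂
  change IsIso ((adj.homEquiv _ _).symm _)
  rw [Adjunction.homEquiv_counit]
  exact IsIso.comp_isIso' (@Functor.map_isIso _ _ _ _ _ _ _ _ h₃) inferInstance

/-- For the identity square, the mate is the unit of `Sh(f)^* ⊣ Sh(f)_*`, carried along
`Sh(𝟭)^* C_𝟭^*`, followed by invertible maps. -/
lemma isLocallyExact_identitySquare_iff :
    IsLocallyExact J J J K (identitySquare f) ↔ IsIso (geomSh J K f).adj.unit := by
  let E := (geomC J J (𝟭 C)).inverseImage
  let P := geomSh J J (𝟭 C)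
  have hR : P.directImage.IsEquivalence := isEquivalence_sheafPushforwardContinuous_id J
  have hL : P.inverseImage.IsEquivalence := P.adj.isEquivalence_left_of_isEquivalence_right
  have hE : E.IsEquivalence :=
    have : (geomSh J J (𝟭 C)).directImage.IsEquivalence := hR
    Functor.isEquivalence_of_iso (sheafRestrictIso J J (𝟭 C)).symm
  have key (X : Sheaf J (Type w)) : IsIso ((sheafCell J J J K (identitySquare f)).app X) ↔
      IsIso ((geomSh J K f).adj.unit.app X) := by
    have e : (sheafCell J J J K (identitySquare f)).app X =
        (E ⋙ P.inverseImage).map ((geomSh J K f).adj.unit.app X) ≫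
          P.inverseImage.map ((restrictCell J J J K (identitySquare f)).app
            ((geomSh J K f).inverseImage.obj X)) ≫
          P.adj.counit.app ((geomC J K f).inverseImage.obj
            ((geomSh J K f).inverseImage.obj X)) := by
      simp [sheafCell, mateEquiv, E, P]
    have h₁ := isIso_restrictCell_identitySquare_app J K f ((geomSh J K f).inverseImage.obj X)
    have h₂ := IsIso.comp_isIso' (@Functor.map_isIso _ _ _ _ _ _ P.inverseImage _ h₁)
      (inferInstance : IsIso (P.adj.counit.app ((geomC J K f).inverseImage.obj
        ((geomSh J K f).inverseImage.obj X))))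
    rw [e]
    refine Iff.trans ⟨fun h => @IsIso.of_isIso_comp_right _ _ _ _ _ _ _ h₂ h,
      fun h => IsIso.comp_isIso' h h₂⟩ ?_
    -- `E ⋙ P.inverseImage` is an equivalence, hence reflects isomorphisms.
    exact isIso_iff_of_reflects_iso _ (E ⋙ P.inverseImage)
  rw [IsLocallyExact, NatTrans.isIso_iff_isIso_app, NatTrans.isIso_iff_isIso_app]
  exact forall_congr' key
end
end

end SiteSquares

theorem mainTheorem7 {C : Type u₁} [Category.{w} C] {D : Type u₂} [Category.{w} D]
    (J : GrothendieckTopology C) (K : GrothendieckTopology D)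
    [IsSmallGenerated.{w} J] [IsSmallGenerated.{w} K]
    (f : C ⥤ D) [IsMorphismOfSites J K f] [f.IsCocontinuous J K] :
    ((geomSh J K f).IsLocal ↔ IsLocallyExact J J J K (identitySquare f)) ∧
    (((geomSh J K f).IsLocal ∧ (geomC J K f).IsLeftAdjointSection (geomSh J K f)) ↔
      IsLocallyExact J J J K (identitySquare f)) ∧
    (IsLocallyExact J J J K (identitySquare f) ↔ IsLocallyFullyFaithful J f) := by
  rw [isLocallyExact_identitySquare_iff, isLocal_geomSh_iff]
  refine ⟨Iff.rfl, and_iff_left_of_imp (isLeftAdjointSection_geomC J K f), ?_⟩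
  exact (restrictTriple J K f).isIso_unit_iff_isIso_counit.trans
    ((isIso_counit_iff_W_yonedaToRestrict (restrictTriple J K f).adj₂).trans
      (W_yonedaToRestrict_iff J K f))
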